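/- Let $\Gamma=H(11,2)$ be the Hamming graph with vertex set $\{0,1\}^{\mathbb F_{11}}$, two vertices being adjacent when they differ in exactly one entry; let $\mathrm{Aut}(\Gamma)$ be its automorphism group and $N\cong S_2^{11}$ the subgroup of automorphisms that act by a permutation of $\{0,1\}$ in each entry, that is, the kernel of the action of $\mathrm{Aut}(\Gamma)$ on the set of entries. For a code $C\subseteq V(\Gamma)$ let $\mathrm{Aut}(C)$ be its setwise stabiliser in $\mathrm{Aut}(\Gamma)$, let $C_r$ be the set of vertices whose Hamming distance to $C$ is exactly $r$ (so $C_0=C$), and let $\rho$ be the covering radius of $C$, the largest $r$ with $C_r\neq\emptyset$. For a subgroup $X\le\mathrm{Aut}(C)$, the code $C$ is $(X,s)$-neighbour transitive if each of $C,C_1,\dots,C_s$ is an $X$-orbit; it is $X$-completely transitive if it is $(X,\rho)$-neighbour transitive. It is entry-faithful $(X,s)$-neighbour transitive if moreover $X$ acts faithfully on entries, that is, $X\cap N=1$. Let $H_{12}$ be the $12\times 12$ matrix with columns labelled by $\mathbb F_{11}\cup\{*\}$ whose rows are the $11$ translates under the additive group of $\mathbb F_{11}$ (which fixes $*$) of the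 vector $v$ with $v_a=-1$ if $a$ is a square in $\mathbb F_{11}$ (including $0$) and $v_a=1$ if $a$ is a non-square or $a=*$, together with the constant row $(-1,\dots,-1)$. The Hadamard code of length $12$ consists of the rows of $H_{12}$ and $-H_{12}$, with $1$ replaced by $0$ and $-1$ replaced by $1$; the punctured Hadamard 12 code $\mathcal P\subseteq V(\Gamma)$ is obtained from it by deleting the coordinate $*$; and $\mathcal E$ is the subcode of $\mathcal P$ consisting of the codewords of even weight. Then: 1. for every subgroup $X\le\mathrm{Aut}(\Gamma)$, the code $\mathcal E$ is entry-faithful $(X,2)$-neighbour transitive if and only if $X=\mathrm{Aut}(\mathcal E)$; 2. $\mathrm{Aut}(\mathcal E)$ is isomorphic to the Mathieu group $M_{11}$; 3. $\mathrm{Aut}(\mathcal E)$ acts faithfully on entries; 4. $\mathcal E$ is not $(X,3)$-neighbour transitive for any group $X$; in particular, $\mathcal E$ is not $X$-completely transitive for any group $X$. -/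

import Mathlib

open scoped Pointwise

/-- The Hamming graph `H(m, q)`, with set of entries `M` and alphabet `Q`: the vertices are the
tuples `M → Q`, and two vertices are adjacent when they differ in exactly one entry. -/
def hammingGraph (M Q : Type*) [Fintype M] [DecidableEq Q] : SimpleGraph (M → Q) where
  Adj α β := hammingDist α β = 1
  symm := ⟨fun α β h => by rw [hammingDist_comm]; exact h⟩
  loopless := ⟨fun α h => by simp at h⟩

/-- The full automorphism group of the Hamming graph, acting on the vertices. -/
abbrev HammingAut (M Q : Type*) [Fintype M] [DecidableEq Q] : Type _ :=
  hammingGraph M Q ≃g hammingGraph M Q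

/-- The base group `N ≅ S_q ^ m` of the automorphism group of the Hamming graph: the
automorphisms `(h_i)` applying a permutation `h_i` of the alphabet in each entry `i`.
It is the kernel of the action of the automorphism group on the set of entries. -/
def baseGroup (M Q : Type*) [Fintype M] [DecidableEq Q] : Subgroup (HammingAut M Q) where
  carrier := {x | ∃ h : M → Equiv.Perm Q, ∀ α i, x α i = h i (α i)}
  one_mem' := ⟨fun _ => 1, fun _ _ => rfl⟩
  mul_mem' := by
    rintro x y ⟨g, hg⟩ ⟨h, hh⟩
    exact ⟨fun i => g i * h i, fun α i => by
      rw [RelIso.mul_apply, hg, hh, Equiv.Perm.mul_apply]⟩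
  inv_mem' := by
    rintro x ⟨g, hg⟩
    refine ⟨fun i => (g i)⁻¹, fun α i => ?_⟩
    rw [Equiv.Perm.eq_inv_iff_eq, ← hg, RelIso.apply_inv_self]

section Codes

variable {M Q : Type*} [Fintype M] [DecidableEq Q]

/-- The automorphism group of a code: its setwise stabiliser in the automorphism group of the
Hamming graph. -/
def codeAut (C : Set (M → Q)) : Subgroup (HammingAut M Q) :=
  MulAction.stabilizer (HammingAut M Q) C

/-- The set `C_r` of vertices whose distance to the code `C` is exactly `r`; `C_0 = C`. -/
def neighbourSet (C : Set (M → Q)) (r : ℕ) : Set (M → Q) :=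
  {α | IsLeast {d | ∃ β ∈ C, hammingDist α β = d} r}

/-- The covering radius: the largest distance of a vertex to the code. -/
noncomputable def coveringRadius (C : Set (M → Q)) : ℕ :=
  sSup {r | (neighbourSet C r).Nonempty}

/-- `C` is `(X, s)`-neighbour transitive: `X` is a group of automorphisms of `C`, and each of
`C = C_0, C_1, …, C_s` is an orbit of `X` on the vertices. -/
def IsNeighbourTransitive (X : Subgroup (HammingAut M Q)) (s : ℕ) (C : Set (M → Q)) : Prop :=
  X ≤ codeAut C ∧ ∀ i ≤ s, ∃ α, neighbourSet C i = MulAction.orbit X α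

/-- `C` is `X`-completely transitive. -/
def IsCompletelyTransitive (X : Subgroup (HammingAut M Q)) (C : Set (M → Q)) : Prop :=
  IsNeighbourTransitive X (coveringRadius C) C

/-- `X` acts faithfully on the set of entries. -/
def IsEntryFaithful (X : Subgroup (HammingAut M Q)) : Prop :=
  X ⊓ baseGroup M Q = ⊥

end Codes

/-- The normalised Hadamard matrix of order 12 from the Paley construction, with entries
labelled by `𝔽₁₁ ∪ {*}`, where `*` is `none`. Row `some b` is the translate by `b` of the vector
that is `-1` at the squares of `𝔽₁₁` (including `0`) and `1` at the non-squares and at `*`;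
row `none` is the constant vector `-1`. -/
def paleyHadamard : Matrix (Option (ZMod 11)) (Option (ZMod 11)) ℤ
  | some b, some a => if IsSquare (a - b) then -1 else 1
  | some _, none => 1
  | none, _ => -1

/-- The Hadamard code of length 12: the rows `u` of `H₁₂` and of `-H₁₂`, with `1` replaced by `0`
and `-1` replaced by `1`. -/
def hadamardCode : Set (Option (ZMod 11) → ZMod 2) :=
  {α | ∃ u : Option (ZMod 11) → ℤ, (∃ r, u = paleyHadamard r ∨ u = -paleyHadamard r) ∧
    ∀ a, α a = if u a = 1 then 0 else 1}

/-- The punctured Hadamard 12 code: the coordinate `*` is deleted. -/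
def puncturedHadamardCode : Set (ZMod 11 → ZMod 2) :=
  (fun α a => α (some a)) '' hadamardCode

/-- The even weight subcode of the punctured Hadamard 12 code. -/
def evenHadamardCode : Set (ZMod 11 → ZMod 2) :=
  {α ∈ puncturedHadamardCode | Even (hammingNorm α)}

/-- The Mathieu group `M₁₁`, by its standard generators on 11 points (here numbered from 0)
`(1,2,3,4,5,6,7,8,9,10,11)` and `(3,7,11,8)(4,10,5,6)`. -/
def mathieuM11 : Subgroup (Equiv.Perm (Fin 11)) :=
  Subgroup.closure {finRotate 11,
    List.formPerm [2, 6, 10, 7] * List.formPerm [3, 9, 4, 5]}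

/-!
Let `E` be the code. It has 12 words, pairwise at distance 6, so that the balls of radius 2 about
them are disjoint.

If `E` is `(X, 2)`-neighbour transitive, then `X` is transitive on the `12 * 55 = 660` vertices at
distance 2 from `E`, and hence has an element of order 3. The words of `E` are the vertices of a
regular simplex, so the number of words fixed by an automorphism can be read off its trace; an
automorphism of odd order turns out to fix one. The stabiliser of a word in `X` therefore has order
divisible by 3, and `1980 = lcm (660, 36)` divides the order of `X`.

Conversely, `Aut(E)` is small: it preserves, up to sign, the third moments of the words of `E`, and
these show that an automorphism fixing four suitable entries is trivial. Hence `Aut(E)` has order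
at most `11 * 10 * 9 * 8 = 7920` and acts faithfully on entries, and `X` has index at most 4 in it.
A subgroup of index less than 5 contains every element of order 5 or 11; in particular it contains
the normaliser of the Sylow 11-subgroup of translations of `𝔽₁₁`, which has order 55. By Frattini's
argument `X = Aut(E)`.

The standard generators of `M₁₁` lift to automorphisms of `E`, and the group they generate makes `E`
2-neighbour transitive, so it is all of `Aut(E)`. At distance 3 from `E` there are two kinds of
vertices, which differ in the number of words of `E` at distance 3.
-/

section Group

variable {G : Type*} [Group G] {p : ℕ} {H K : Subgroup G}

theorem mem_of_pow_prime_pow_eq_one (hp : p.Prime) (h0 : H.relIndex K ≠ 0) (hlt : H.relIndex K < p)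
    {y : G} (hyK : y ∈ K) {k : ℕ} (hy : y ^ p ^ k = 1) : y ∈ H := by
  obtain ⟨n, hn0, hn, hyn⟩ := Subgroup.exists_pow_mem_of_relIndex_ne_zero h0 hyK
  have hcop : n.Coprime (orderOf y) :=
    ((Nat.coprime_of_lt_prime hn0.ne' (hn.trans_lt hlt) hp).symm.pow_right k).coprime_dvd_right
      (orderOf_dvd_of_pow_eq_one hy)
  obtain ⟨m, hm⟩ := exists_pow_eq_self_of_coprime hcop
  exact hm ▸ pow_mem hyn.1 m

/-- By the first hypothesis the normal core of `H` contains every `p`-element, so that Frattini's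
argument applies to it. -/
theorem eq_top_of_index_lt_of_normalizer_le [Finite G] [Fact p.Prime] (hlt : H.index < p)
    (P : Sylow p G) (hP : Subgroup.normalizer (P : Set G) ≤ H) : H = ⊤ := by
  have hcore : P ≤ H.normalCore := fun y hy g => by
    obtain ⟨k, hk⟩ := P.isPGroup' ⟨y, hy⟩
    have hyk : y ^ p ^ k = 1 := congrArg Subtype.val hk
    have h0 : H.index ≠ 0 := Subgroup.index_ne_zero_of_finite
    rw [← H.relIndex_top_right] at hlt h0
    exact mem_of_pow_prime_pow_eq_one Fact.out h0 hlt (Subgroup.mem_top _) (k := k)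
      (by rw [conj_pow, hyk, mul_one, mul_inv_cancel])
  rw [eq_top_iff, ← P.normalizer_sup_eq_top' hcore]
  exact sup_le hP H.normalCore_le

theorem card_orbit_mul_orderOf_dvd_card {α : Type*} [MulAction G α] {g : G} {a : α}
    (hg : g • a = a) : Nat.card (MulAction.orbit G a) * orderOf g ∣ Nat.card G := by
  rw [← (MulAction.stabilizer G a).index_mul_card, MulAction.index_stabilizer]
  exact mul_dvd_mul_left _ ((MulAction.stabilizer G a).orderOf_dvd_natCard hg)

end Group

section HammingAut

variable {M Q : Type*} [Fintype M] [DecidableEq Q]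

instance [Finite Q] : Finite (HammingAut M Q) :=
  Finite.of_injective (fun x : HammingAut M Q => (x : (M → Q) → M → Q)) DFunLike.coe_injective

theorem exists_hammingDist_eq_one_of_succ {α β : M → Q} {n : ℕ} (h : hammingDist α β = n + 1) :
    ∃ γ, hammingDist α γ = 1 ∧ hammingDist γ β = n := by
  classical
  obtain ⟨i, hi⟩ : ∃ i, α i ≠ β i := by
    by_contra! hαβ
    simp [funext hαβ] at h
  refine ⟨Function.update α i (β i), Finset.card_eq_one.2 ⟨i, ?_⟩, ?_⟩
  · ext j
    rcases eq_or_ne j i with rfl | hj <;> simp_all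
  · have herase : ({j | Function.update α i (β i) j ≠ β j} : Finset M) =
        ({j | α j ≠ β j} : Finset M).erase i := by
      ext j
      rcases eq_or_ne j i with rfl | hj <;> simp_all
    rw [hammingDist, herase, Finset.card_erase_of_mem (by simpa using hi)]
    exact Nat.sub_eq_of_eq_add h

theorem hammingDist_map_le (x : HammingAut M Q) (α β : M → Q) :
    hammingDist (x α) (x β) ≤ hammingDist α β := by
  induction h : hammingDist α β generalizing α with
  | zero => simp [hammingDist_eq_zero.1 h]
  | succ n ih =>
    obtain ⟨γ, hαγ, hγβ⟩ := exists_hammingDist_eq_one_of_succ h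
    have hx : hammingDist (x α) (x γ) = 1 := x.map_rel_iff.2 hαγ
    have := hammingDist_triangle (x α) (x γ) (x β)
    have := ih γ hγβ
    omega

theorem hammingDist_map (x : HammingAut M Q) (α β : M → Q) :
    hammingDist (x α) (x β) = hammingDist α β :=
  (hammingDist_map_le x α β).antisymm (by simpa using hammingDist_map_le x⁻¹ (x α) (x β))

theorem neighbourSet_zero (C : Set (M → Q)) : neighbourSet C 0 = C := by
  ext α
  simp [neighbourSet, IsLeast, lowerBounds]

theorem le_coveringRadius {C : Set (M → Q)} {r : ℕ} (h : (neighbourSet C r).Nonempty) :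
    r ≤ coveringRadius C := by
  refine le_csSup ⟨Fintype.card M, ?_⟩ h
  rintro s ⟨α, ⟨β, -, rfl⟩, -⟩
  exact hammingDist_le_card_fintype

theorem map_mem_neighbourSet {C : Set (M → Q)} {x : HammingAut M Q} (hx : x ∈ codeAut C) {r : ℕ}
    {α : M → Q} (hα : α ∈ neighbourSet C r) : x α ∈ neighbourSet C r := by
  have hC : ∀ β, x β ∈ C ↔ β ∈ C := fun β => MulAction.mem_stabilizer_set.1 hx β
  have hdist : {d | ∃ β ∈ C, hammingDist (x α) β = d} = {d | ∃ β ∈ C, hammingDist α β = d} :=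
    Set.ext fun d => x.surjective.exists.trans <| exists_congr fun β => by
      rw [hC, hammingDist_map]
  rw [neighbourSet, Set.mem_ofPred_eq, hdist]
  exact hα

theorem IsNeighbourTransitive.mono {X : Subgroup (HammingAut M Q)} {s t : ℕ} {C : Set (M → Q)}
    (h : IsNeighbourTransitive X t C) (hst : s ≤ t) :
    IsNeighbourTransitive X s C :=
  ⟨h.1, fun i hi => h.2 i (hi.trans hst)⟩

theorem mem_neighbourSet_of_hammingDist_eq {C : Set (M → Q)} {r : ℕ} {α β : M → Q} (hβ : β ∈ C)
    (hC : ∀ γ ∈ C, γ ≠ β → 2 * r ≤ hammingDist γ β) (hα : hammingDist α β = r) :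
    α ∈ neighbourSet C r := by
  refine ⟨⟨β, hβ, hα⟩, ?_⟩
  rintro _ ⟨γ, hγ, rfl⟩
  rcases eq_or_ne γ β with rfl | hne
  · exact hα.ge
  · have := hammingDist_triangle_left γ β α
    have := hC γ hγ hne
    omega

theorem neighbourSet_eq_orbit {C : Set (M → Q)} {X : Subgroup (HammingAut M Q)}
    (hX : X ≤ codeAut C) {α β : M → Q} {r : ℕ} (hβ : C = MulAction.orbit X β)
    (hα : α ∈ neighbourSet C r)
    (hlocal : ∀ γ, hammingDist γ β = r → γ ∈ MulAction.orbit X α) :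
    neighbourSet C r = MulAction.orbit X α := by
  refine Set.Subset.antisymm (fun γ hγ => ?_) ?_
  · obtain ⟨⟨δ, hδ, hγδ⟩, -⟩ := hγ
    rw [hβ] at hδ
    obtain ⟨x, rfl⟩ := hδ
    have hx : hammingDist (x⁻¹ • γ) β = r := by
      rw [← hγδ, ← hammingDist_map (x : HammingAut M Q)]
      exact congrArg₂ hammingDist (smul_inv_smul x γ) rfl
    simpa using MulAction.mem_orbit_of_mem_orbit x (hlocal _ hx)
  · rintro _ ⟨x, rfl⟩
    exact map_mem_neighbourSet (hX x.2) hα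

theorem card_neighbourSet [AddGroup Q] {C : Set (M → Q)} {r : ℕ}
    (hC : ∀ β ∈ C, ∀ γ ∈ C, β ≠ γ → 2 * r < hammingDist β γ) :
    Nat.card (neighbourSet C r) = Nat.card C * Nat.card {α : M → Q | hammingNorm α = r} := by
  have hdist (α β : M → Q) : hammingDist (β + α) β = hammingNorm α := by
    rw [hammingDist_comm, hammingDist_eq_hammingNorm, neg_add_cancel_left]
  let f : C × {α : M → Q | hammingNorm α = r} → neighbourSet C r := fun p =>
    ⟨p.1 + p.2, mem_neighbourSet_of_hammingDist_eq p.1.2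
      (fun γ hγ hne => (hC γ hγ p.1 p.1.2 hne).le) ((hdist _ _).trans p.2.2)⟩
  rw [← Nat.card_prod]
  refine (Nat.card_congr (Equiv.ofBijective f ⟨?_, ?_⟩)).symm
  · rintro ⟨⟨β, hβ⟩, ⟨α, hα⟩⟩ ⟨⟨γ, hγ⟩, ⟨δ, hδ⟩⟩ h
    replace h : β + α = γ + δ := congrArg Subtype.val h
    obtain rfl : β = γ := by
      by_contra hne
      have htri := hammingDist_triangle_left β γ (β + α)
      rw [hdist, h, hdist, hα, hδ] at htri
      have := hC β hβ γ hγ hne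
      omega
    obtain rfl : α = δ := add_left_cancel h
    rfl
  · rintro ⟨α, ⟨β, hβ, hαβ⟩, -⟩
    exact ⟨(⟨β, hβ⟩, ⟨-β + α, by
        rw [Set.mem_ofPred_eq, ← hammingDist_eq_hammingNorm, hammingDist_comm, hαβ]⟩),
      Subtype.ext (add_neg_cancel_left β α)⟩

section Range

variable {ι : Type*} {c : ι → M → Q} {x : HammingAut M Q}

theorem mem_codeAut_range_iff [Finite ι] :
    x ∈ codeAut (Set.range c) ↔ ∀ d, ∃ e, x (c d) = c e := by
  rw [codeAut, MulAction.mem_stabilizer_set_iff_smul_set_subset (Set.finite_range c),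
    Set.smul_set_range, Set.range_subset_iff]
  exact forall_congr' fun d => exists_congr fun e => eq_comm

theorem exists_perm_of_mem_codeAut_range [Finite ι] (hc : Function.Injective c)
    (hx : x ∈ codeAut (Set.range c)) : ∃ π : Equiv.Perm ι, ∀ d, x (c d) = c (π d) := by
  choose π hπ using mem_codeAut_range_iff.1 hx
  have hinj : Function.Injective π := fun d e h => hc (x.injective (by rw [hπ, hπ, h]))
  exact ⟨Equiv.ofBijective π (Finite.injective_iff_bijective.1 hinj), hπ⟩

theorem card_hammingDist_map [Fintype ι] {π : Equiv.Perm ι} (hπ : ∀ d, x (c d) = c (π d))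
    (α : M → Q) (r : ℕ) :
    Finset.card {d | hammingDist (x α) (c d) = r} = Finset.card {d | hammingDist α (c d) = r} :=
  (Finset.card_equiv π fun d => by simp [← hπ, hammingDist_map]).symm

end Range

end HammingAut

section Binary

variable {M : Type*} [Fintype M]

theorem card_hammingNorm_eq (r : ℕ) :
    Nat.card {α : M → ZMod 2 | hammingNorm α = r} = (Fintype.card M).choose r := by
  classical
  let support (α : M → ZMod 2) : Finset M := {i | α i ≠ 0}
  have hsupport : Function.Bijective support := by
    refine ⟨fun α β h => funext fun i => ?_, fun S => ⟨fun i => if i ∈ S then 1 else 0, ?_⟩⟩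
    · have hi : α i ≠ 0 ↔ β i ≠ 0 := by simpa [support] using Finset.ext_iff.1 h i
      have h2 : ∀ y z : ZMod 2, (y ≠ 0 ↔ z ≠ 0) → y = z := by decide
      exact h2 _ _ hi
    · ext i
      simp [support]
  have hcard := (Equiv.ofBijective support hsupport).subtypeEquiv
    (p := fun α => hammingNorm α = r) (q := fun S => S.card = r) fun _ => Iff.rfl
  rw [Set.coe_ofPred, Nat.card_congr hcard, Nat.card_eq_fintype_card, Fintype.card_finset_len]

theorem hammingNorm_single [DecidableEq M] (i : M) :
    hammingNorm (Pi.single i 1 : M → ZMod 2) = 1 := by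
  refine Finset.card_eq_one.2 ⟨i, ?_⟩
  ext j
  rcases eq_or_ne j i with rfl | hj <;> simp_all

theorem exists_eq_single_of_hammingNorm_eq_one [DecidableEq M] {α : M → ZMod 2}
    (h : hammingNorm α = 1) : ∃ i, α = Pi.single i 1 := by
  have h01 : ∀ z : ZMod 2, z ≠ 0 → z = 1 := by decide
  obtain ⟨i, hi⟩ := Finset.card_eq_one.1 h
  have hsupp (j : M) : α j ≠ 0 ↔ j = i := by simpa using Finset.ext_iff.1 hi j
  refine ⟨i, funext fun j => ?_⟩
  rcases eq_or_ne j i with rfl | hji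
  · simpa using h01 _ ((hsupp j).2 rfl)
  · simpa [hji] using (hsupp j).not.2 hji

theorem exists_eq_single_add_single_of_hammingNorm_eq_two [DecidableEq M] {α : M → ZMod 2}
    (h : hammingNorm α = 2) : ∃ i j, i ≠ j ∧ α = Pi.single i 1 + Pi.single j 1 := by
  obtain ⟨γ, hαγ, hγ⟩ := exists_hammingDist_eq_one_of_succ ((hammingDist_zero_right α).trans h)
  rw [hammingDist_zero_right] at hγ
  rw [hammingDist_comm, hammingDist_eq_hammingNorm] at hαγ
  obtain ⟨i, rfl⟩ := exists_eq_single_of_hammingNorm_eq_one hγ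
  obtain ⟨j, hj⟩ := exists_eq_single_of_hammingNorm_eq_one hαγ
  obtain rfl := neg_add_eq_iff_eq_add.1 hj
  refine ⟨i, j, ?_, rfl⟩
  rintro rfl
  simp [ZModModule.add_self] at h

theorem hammingDist_single_lt_iff [DecidableEq M] (α : M → ZMod 2) (i : M) :
    hammingDist α (Pi.single i 1) < hammingNorm α ↔ α i = 1 := by
  have h01 : ∀ z : ZMod 2, z ≠ 1 → z = 0 := by decide
  constructor
  · contrapose!
    intro h
    have h0 := h01 _ h
    refine Finset.card_le_card fun j hj => ?_
    rcases eq_or_ne j i with rfl | hji <;> simp_all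
  · intro h
    refine Finset.card_lt_card (Finset.ssubset_iff_of_subset ?_ |>.2 ⟨i, ?_, ?_⟩)
    · intro j hj
      rcases eq_or_ne j i with rfl | hji <;> simp_all
    · simp [h]
    · simp [h]

/-- After translating so that it fixes `0`, an automorphism permutes the vectors of weight one, and
these determine every vector `α`: `α i = 1` when the `i`-th of them is nearer to `α` than `0` is. -/
theorem exists_perm_apply_eq_add (x : HammingAut M (ZMod 2)) :
    ∃ σ : Equiv.Perm M, ∀ α i, x α (σ i) = α i + x 0 (σ i) := by
  classical
  have hdist (α β : M → ZMod 2) : hammingDist (x α - x 0) (x β - x 0) = hammingDist α β := by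
    rw [← hammingDist_map x α β, hammingDist_eq_hammingNorm, hammingDist_eq_hammingNorm]
    congr 1
    abel
  have hnorm (α : M → ZMod 2) : hammingNorm (x α - x 0) = hammingNorm α := by
    rw [← hammingDist_zero_right α, ← hdist α 0, sub_self, hammingDist_zero_right]
  choose f hf using fun i : M =>
    exists_eq_single_of_hammingNorm_eq_one ((hnorm _).trans (hammingNorm_single i))
  have hinj : Function.Injective f := fun i j hij => by
    have hij' : (Pi.single i 1 : M → ZMod 2) = Pi.single j 1 := by
      rw [← hammingDist_eq_zero, ← hdist, hf, hf, hij, hammingDist_self]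
    by_contra hne
    simpa [hne] using congrFun hij' i
  refine ⟨Equiv.ofBijective f (Finite.injective_iff_bijective.1 hinj), fun α i => ?_⟩
  have hone : (x α - x 0) (f i) = 1 ↔ α i = 1 := by
    rw [← hammingDist_single_lt_iff, ← hammingDist_single_lt_iff, hnorm, ← hf, hdist]
  have h2 : ∀ a b c : ZMod 2, (a - b = 1 ↔ c = 1) → a = c + b := by decide
  exact h2 _ _ _ hone

theorem existsUnique_perm_apply_eq_add (x : HammingAut M (ZMod 2)) :
    ∃! σ : Equiv.Perm M, ∀ α i, x α (σ i) = α i + x 0 (σ i) := by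
  classical
  obtain ⟨σ, hσ⟩ := exists_perm_apply_eq_add x
  refine ⟨σ, hσ, fun τ hτ => Equiv.ext fun i => ?_⟩
  obtain ⟨j, hj⟩ := σ.surjective (τ i)
  have hi := hτ (Pi.single i 1) i
  rw [← hj, hσ, add_left_inj] at hi
  rw [← hj, show j = i by by_contra hne; simp [hne] at hi]

/-- The action of the automorphism group of a binary Hamming graph on the entries: an automorphism
permutes the entries and then adds the image of `0`. -/
noncomputable def entryPerm : HammingAut M (ZMod 2) →* Equiv.Perm M where
  toFun x := (existsUnique_perm_apply_eq_add x).choose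
  map_one' := (existsUnique_perm_apply_eq_add 1).unique
    (existsUnique_perm_apply_eq_add 1).choose_spec.1 (by simp)
  map_mul' x y := by
    refine (existsUnique_perm_apply_eq_add (x * y)).unique
      (existsUnique_perm_apply_eq_add (x * y)).choose_spec.1 fun α i => ?_
    have hx := (existsUnique_perm_apply_eq_add x).choose_spec.1
    have hy := (existsUnique_perm_apply_eq_add y).choose_spec.1
    rw [RelIso.mul_apply, RelIso.mul_apply, Equiv.Perm.mul_apply, hx (y α), hx (y 0), hy α,
      add_assoc]

theorem apply_entryPerm (x : HammingAut M (ZMod 2)) (α : M → ZMod 2) (i : M) :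
    x α (entryPerm x i) = α i + x 0 (entryPerm x i) :=
  (existsUnique_perm_apply_eq_add x).choose_spec.1 α i

theorem entryPerm_eq {x : HammingAut M (ZMod 2)} {σ : Equiv.Perm M}
    (hσ : ∀ α i, x α (σ i) = α i + x 0 (σ i)) : entryPerm x = σ :=
  (existsUnique_perm_apply_eq_add x).unique (apply_entryPerm x) hσ

theorem eq_of_entryPerm_eq {x y : HammingAut M (ZMod 2)} (h : entryPerm x = entryPerm y)
    (h0 : x 0 = y 0) : x = y := by
  refine RelIso.ext fun α => funext fun i => ?_
  obtain ⟨j, rfl⟩ := (entryPerm x).surjective i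
  rw [apply_entryPerm x, h0, h, ← apply_entryPerm y]

theorem map_add_of_map_zero {x : HammingAut M (ZMod 2)} (h0 : x 0 = 0) (α β : M → ZMod 2) :
    x (α + β) = x α + x β := by
  ext j
  obtain ⟨i, rfl⟩ := (entryPerm x).surjective j
  rw [Pi.add_apply, apply_entryPerm x (α + β), apply_entryPerm x α, apply_entryPerm x β, h0,
    Pi.add_apply, Pi.zero_apply, add_zero, add_zero, add_zero]

theorem map_single_of_map_zero [DecidableEq M] {x : HammingAut M (ZMod 2)} (h0 : x 0 = 0) (i : M) :
    x (Pi.single i 1) = Pi.single (entryPerm x i) 1 := by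
  ext j
  obtain ⟨k, rfl⟩ := (entryPerm x).surjective j
  simp [apply_entryPerm x (Pi.single i 1), h0, Pi.single_apply]

theorem pow_apply_of_entryPerm_eq {x : HammingAut M (ZMod 2)} {a : M}
    (ha : entryPerm x a = a) (k : ℕ) (α : M → ZMod 2) :
    (x ^ k) α a = α a + k • x 0 a := by
  induction k generalizing α with
  | zero => simp
  | succ k ih =>
    have hx := apply_entryPerm x α a
    rw [ha] at hx
    rw [pow_succ, RelIso.mul_apply, ih, hx, succ_nsmul', add_assoc]

theorem entryPerm_eq_one_of_mem_baseGroup {x : HammingAut M (ZMod 2)}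
    (hx : x ∈ baseGroup M (ZMod 2)) : entryPerm x = 1 := by
  obtain ⟨h, hh⟩ := hx
  refine entryPerm_eq fun α i => ?_
  have h2 : ∀ (e : Equiv.Perm (ZMod 2)) (z : ZMod 2), e z = z + e 0 := by decide
  rw [hh, hh]
  exact h2 _ _

theorem isEntryFaithful_of_forall_eq_one {X : Subgroup (HammingAut M (ZMod 2))}
    (hX : ∀ x ∈ X, entryPerm x = 1 → x = 1) : IsEntryFaithful X :=
  (Subgroup.eq_bot_iff_forall _).2 fun x hx => hX x hx.1 (entryPerm_eq_one_of_mem_baseGroup hx.2)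

/-- The automorphism permuting the entries by `σ` and then adding the vector `t`. -/
def signedPerm (σ : Equiv.Perm M) (t : M → ZMod 2) : HammingAut M (ZMod 2) where
  toFun α i := α (σ.symm i) + t i
  invFun α i := α (σ i) - t (σ i)
  left_inv α := by ext i; simp
  right_inv α := by ext i; simp
  map_rel_iff' {α β} := by
    have hdist : hammingDist (fun i => α (σ.symm i) + t i) (fun i => β (σ.symm i) + t i) =
        hammingDist α β := Finset.card_equiv σ.symm fun i => by simp
    simp only [hammingGraph, Equiv.coe_fn_mk, hdist]

theorem signedPerm_apply (σ : Equiv.Perm M) (t α : M → ZMod 2) (i : M) :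
    signedPerm σ t α i = α (σ.symm i) + t i := rfl

@[simp]
theorem signedPerm_zero (σ : Equiv.Perm M) (t : M → ZMod 2) : signedPerm σ t 0 = t := by
  ext i; simp [signedPerm_apply]

@[simp]
theorem entryPerm_signedPerm (σ : Equiv.Perm M) (t : M → ZMod 2) :
    entryPerm (signedPerm σ t) = σ :=
  entryPerm_eq fun α i => by simp [signedPerm_apply]

/-- The action of the symmetric group on the vertices by permutation of the entries. -/
def permAut : Equiv.Perm M →* HammingAut M (ZMod 2) where
  toFun σ := signedPerm σ 0
  map_one' := RelIso.ext fun α => funext fun _ => add_zero _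
  map_mul' σ τ := eq_of_entryPerm_eq (by simp) (by simp [RelIso.mul_apply])

theorem permAut_apply (σ : Equiv.Perm M) (α : M → ZMod 2) (i : M) :
    permAut σ α i = α (σ.symm i) := add_zero _

@[simp]
theorem permAut_zero (σ : Equiv.Perm M) : permAut σ 0 = 0 := signedPerm_zero σ 0

@[simp]
theorem entryPerm_permAut (σ : Equiv.Perm M) : entryPerm (permAut σ) = σ := entryPerm_signedPerm σ 0

theorem signedPerm_mem_codeAut_range {ι : Type*} [Finite ι] {c : ι → M → ZMod 2}
    {σ : Equiv.Perm M} {t : M → ZMod 2}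
    (h : ∀ d, ∃ e, ∀ i, c d (σ.symm i) + t i = c e i) :
    signedPerm σ t ∈ codeAut (Set.range c) :=
  mem_codeAut_range_iff.2 fun d => (h d).imp fun _ he => funext he

end Binary

section SignMatrix

/-- The non-trivial character `z ↦ (-1) ^ z` of the binary alphabet. -/
def binarySign : AddChar (ZMod 2) ℤ where
  toFun z := if z = 0 then 1 else -1
  map_zero_eq_one' := rfl
  map_add_eq_mul' := by decide

variable {M : Type*} [Fintype M] {x : HammingAut M (ZMod 2)}

section Moment

variable {ι : Type*} [Fintype ι] {c : ι → M → ZMod 2}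

/-- The moment `∑ d, (-1) ^ (c d (u 0) + ⋯ + c d (u (k - 1)))` of a family of codewords at the
entries `u`; automorphisms of the code preserve it up to a sign. -/
def signMoment (c : ι → M → ZMod 2) {k : ℕ} (u : Fin k → M) : ℤ :=
  ∑ d, binarySign (∑ j, c d (u j))

theorem signMoment_entryPerm {π : Equiv.Perm ι} (hπ : ∀ d, x (c d) = c (π d)) {k : ℕ}
    (u : Fin k → M) : signMoment c (entryPerm x ∘ u) =
      binarySign (∑ j, x 0 (entryPerm x (u j))) * signMoment c u := by
  simp only [signMoment, Finset.mul_sum, ← AddChar.map_add_eq_mul, ← Finset.sum_add_distrib]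
  rw [← Equiv.sum_comp π]
  refine Finset.sum_congr rfl fun d _ => congrArg _ (Finset.sum_congr rfl fun j _ => ?_)
  rw [← hπ, Function.comp_apply, apply_entryPerm, add_comm]

end Moment

/-- The matrix of signs of a family of binary vectors, bordered by a column of ones. -/
def signMatrix (c : Option M → M → ZMod 2) : Matrix (Option M) (Option M) ℤ
  | _, none => 1
  | d, some a => binarySign (c d a)

theorem signMatrix_map {c : Option M → M → ZMod 2} {π : Equiv.Perm (Option M)}
    (hπ : ∀ d, x (c d) = c (π d)) (d : Option M) (a : M) :
    signMatrix c (π d) (some (entryPerm x a)) =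
      signMatrix c d (some a) * binarySign (x 0 (entryPerm x a)) := by
  simp only [signMatrix]
  rw [← hπ, apply_entryPerm, AddChar.map_add_eq_mul]

variable [DecidableEq M] {c : Option M → M → ZMod 2}

theorem isHadamard_signMatrix
    (hc : ∀ d e, d ≠ e → 2 * hammingDist (c d) (c e) = Fintype.card (Option M)) :
    (signMatrix c).IsHadamard := by
  have hsign : ∀ y z, binarySign y * binarySign z = 1 - 2 * if y ≠ z then 1 else 0 := by decide
  have hrow (d e : Option M) : ∑ j, signMatrix c d j * signMatrix c e j =
      Fintype.card (Option M) - 2 * hammingDist (c d) (c e) := by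
    simp only [Fintype.sum_option, signMatrix, hsign, Finset.sum_sub_distrib, ← Finset.mul_sum,
      Finset.sum_boole, hammingDist, Fintype.card_option]
    simp only [Finset.sum_const, Finset.card_univ, nsmul_eq_mul]
    push_cast
    ring
  refine .of_mul_conjTranspose (fun d j => ?_) (Matrix.ext fun d e => ?_) ?_
  · have hone : ∀ z, binarySign z * binarySign z = 1 := by decide
    cases j <;> simp [signMatrix, Unitary.mem_iff, hone]
  · rw [Matrix.mul_apply, Matrix.smul_apply, Matrix.one_apply]
    simp only [Matrix.conjTranspose_apply, star_trivial, hrow]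
    rcases eq_or_ne d e with rfl | hde
    · simp
    · have := hc d e hde
      simp only [hde, if_false, smul_zero]
      omega
  · exact IsRegular.of_ne_zero (by exact_mod_cast Fintype.card_ne_zero)

theorem sum_signMatrix_mul_row (hc : (signMatrix c).IsHadamard) (d e : Option M) :
    ∑ j, signMatrix c d j * signMatrix c e j =
      if d = e then (Fintype.card (Option M) : ℤ) else 0 := by
  simpa [Matrix.mul_apply, Matrix.one_apply] using congrFun₂ hc.mul_conjTranspose d e

theorem sum_signMatrix_mul_col (hc : (signMatrix c).IsHadamard) (i j : Option M) :
    ∑ d, signMatrix c d i * signMatrix c d j =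
      if i = j then (Fintype.card (Option M) : ℤ) else 0 := by
  simpa [Matrix.mul_apply, Matrix.one_apply] using congrFun₂ hc.conjTranspose_mul i j

/-- The codewords form a regular simplex, so the number of fixed codewords is one more than the
trace of the automorphism on `ℝ ^ M`. -/
theorem card_fixed_codewords (hc : (signMatrix c).IsHadamard) {π : Equiv.Perm (Option M)}
    (hπ : ∀ d, x (c d) = c (π d)) :
    (Finset.card {d | d = π d} : ℤ) =
      1 + ∑ a with a = entryPerm x a, binarySign (x 0 a) := by
  have hn : (Fintype.card (Option M) : ℤ) ≠ 0 := by exact_mod_cast Fintype.card_ne_zero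
  have hcol (a : M) : ∑ d, signMatrix c d (some (entryPerm x a)) *
      signMatrix c (π d) (some (entryPerm x a)) =
        if a = entryPerm x a then Fintype.card (Option M) * binarySign (x 0 a) else 0 := by
    simp only [signMatrix_map hπ, ← mul_assoc, ← Finset.sum_mul, sum_signMatrix_mul_col hc,
      Option.some_inj, eq_comm (a := entryPerm x a)]
    split_ifs with ha
    · rw [← ha]
    · rw [zero_mul]
  refine mul_left_cancel₀ hn ?_
  calc (Fintype.card (Option M) : ℤ) * Finset.card {d | d = π d}
      = ∑ d, ∑ j, signMatrix c d j * signMatrix c (π d) j := by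
        simp only [sum_signMatrix_mul_row hc, ← Finset.sum_filter, Finset.sum_const, nsmul_eq_mul,
          mul_comm]
    _ = Fintype.card (Option M) + ∑ a, ∑ d, signMatrix c d (some (entryPerm x a)) *
          signMatrix c (π d) (some (entryPerm x a)) := by
        rw [Finset.sum_comm, Fintype.sum_option, Equiv.sum_comp (entryPerm x) fun a =>
          ∑ d, signMatrix c d (some a) * signMatrix c (π d) (some a)]
        simp [signMatrix]
    _ = Fintype.card (Option M) * (1 + ∑ a with a = entryPerm x a, binarySign (x 0 a)) := by
        simp only [hcol, mul_add, mul_one, Finset.mul_sum, Finset.sum_filter, mul_ite, mul_zero]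

theorem exists_fixed_codeword_of_odd_order (hc : (signMatrix c).IsHadamard)
    {π : Equiv.Perm (Option M)} (hπ : ∀ d, x (c d) = c (π d)) {n : ℕ} (hn : Odd n)
    (hxn : x ^ n = 1) : ∃ d, x (c d) = c d := by
  have hzero {a : M} (ha : entryPerm x a = a) : x 0 a = 0 := by
    have h := pow_apply_of_entryPerm_eq ha n 0
    rw [hxn, nsmul_eq_mul, ZMod.natCast_eq_one_iff_odd.2 hn] at h
    simpa using h.symm
  have hcard := card_fixed_codewords hc hπ
  have hsum : 0 ≤ ∑ a with a = entryPerm x a, binarySign (x 0 a) :=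
    Finset.sum_nonneg fun a ha => by
      rw [hzero (Finset.mem_filter.1 ha).2.symm, AddChar.map_zero_eq_one]
      exact zero_le_one
  obtain ⟨d, hd⟩ := Finset.card_pos.1 (show 0 < Finset.card {d | d = π d} by omega)
  exact ⟨d, by rw [hπ, ← (Finset.mem_filter.1 hd).2]⟩

end SignMatrix

section EvenHadamardCode

/-- The codewords of `evenHadamardCode`: the zero vector and the translates of the characteristic
vector of the squares of `𝔽₁₁`. -/
def codeword : Option (ZMod 11) → ZMod 11 → ZMod 2
  | none => 0
  | some b => fun a => if a - b ∈ ({0, 1, 3, 4, 5, 9} : Finset (ZMod 11)) then 1 else 0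

theorem codeword_none : codeword none = 0 := rfl

theorem hammingDist_codeword : ∀ d e, d ≠ e → hammingDist (codeword d) (codeword e) = 6 := by
  decide +kernel

theorem codeword_injective : Function.Injective codeword := fun d e h => by
  by_contra hne
  simpa [h] using hammingDist_codeword d e hne

theorem evenHadamardCode_eq_range : evenHadamardCode = Set.range codeword := by
  let word (u : Option (ZMod 11) → ℤ) (a : ZMod 11) : ZMod 2 := if u (some a) = 1 then 0 else 1
  have hnone : word (-paleyHadamard none) = codeword none := by decide +kernel
  have hsome : ∀ b, word (paleyHadamard (some b)) = codeword (some b) := by decide +kernel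
  have hnone_odd : ¬ Even (hammingNorm (word (paleyHadamard none))) := by decide +kernel
  have hsome_odd : ∀ b, ¬ Even (hammingNorm (word (-paleyHadamard (some b)))) := by decide +kernel
  have heven : ∀ d, Even (hammingNorm (codeword d)) := by decide +kernel
  have hword (α : Option (ZMod 11) → ZMod 2) (u : Option (ZMod 11) → ℤ)
      (h : ∀ a, α a = if u a = 1 then 0 else 1) : (fun a => α (some a)) = word u :=
    funext fun a => h (some a)
  refine Set.Subset.antisymm ?_ ?_
  · rintro _ ⟨⟨α, ⟨u, ⟨_ | b, rfl | rfl⟩, hα⟩, rfl⟩, h⟩ <;>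
      simp only [hword _ _ hα] at h ⊢
    · exact absurd h hnone_odd
    · exact ⟨none, hnone.symm⟩
    · exact ⟨some b, (hsome b).symm⟩
    · exact absurd h (hsome_odd b)
  · rintro _ ⟨_ | b, rfl⟩
    · exact ⟨⟨_, ⟨_, ⟨none, Or.inr rfl⟩, fun _ => rfl⟩, hnone⟩, heven none⟩
    · exact ⟨⟨_, ⟨_, ⟨some b, Or.inl rfl⟩, fun _ => rfl⟩, hsome b⟩, heven (some b)⟩

/-- A base for the action of the automorphism group of `evenHadamardCode` on the entries. -/
def entryBase : Finset (ZMod 11) := {0, 1, 2, 3}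

theorem signMoment_codeword_ne_zero : ∀ i ∈ entryBase, ∀ j ∈ entryBase, ∀ k ∈ entryBase,
    i ≠ j → i ≠ k → j ≠ k → signMoment codeword ![i, j, k] ≠ 0 := by
  decide +kernel

theorem exists_sum_codeword_ne_zero : ∀ b, ∃ i ∈ entryBase, ∃ j ∈ entryBase, ∃ k ∈ entryBase,
    i ≠ j ∧ i ≠ k ∧ j ≠ k ∧
      codeword (some b) i + codeword (some b) j + codeword (some b) k ≠ 0 := by
  decide +kernel

theorem exists_signMoment_codeword_ne : ∀ i j, i ≠ j → ∃ a ∈ entryBase, ∃ b ∈ entryBase,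
    signMoment codeword ![a, b, i] ≠ signMoment codeword ![a, b, j] := by
  decide +kernel

variable {x : HammingAut (ZMod 11) (ZMod 2)}

theorem exists_codewordPerm (hx : x ∈ codeAut evenHadamardCode) :
    ∃ π : Equiv.Perm (Option (ZMod 11)), ∀ d, x (codeword d) = codeword (π d) :=
  exists_perm_of_mem_codeAut_range codeword_injective (evenHadamardCode_eq_range ▸ hx)

theorem exists_map_zero_eq_codeword (hx : x ∈ codeAut evenHadamardCode) :
    ∃ d, x 0 = codeword d :=
  let ⟨π, hπ⟩ := exists_codewordPerm hx
  ⟨π none, hπ none⟩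

theorem signMoment_codeword_entryPerm (hx : x ∈ codeAut evenHadamardCode) (i j k : ZMod 11) :
    signMoment codeword ![entryPerm x i, entryPerm x j, entryPerm x k] =
      binarySign (x 0 (entryPerm x i) + x 0 (entryPerm x j) + x 0 (entryPerm x k)) *
        signMoment codeword ![i, j, k] := by
  obtain ⟨π, hπ⟩ := exists_codewordPerm hx
  have hcomp : entryPerm x ∘ ![i, j, k] = ![entryPerm x i, entryPerm x j, entryPerm x k] := by
    ext l
    fin_cases l <;> rfl
  rw [← hcomp, signMoment_entryPerm hπ, Fin.sum_univ_three]
  rfl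

theorem map_zero_of_fixes_entryBase (hx : x ∈ codeAut evenHadamardCode)
    (hfix : ∀ i ∈ entryBase, entryPerm x i = i) : x 0 = 0 := by
  obtain ⟨_ | b, hb⟩ := exists_map_zero_eq_codeword hx
  · exact hb
  obtain ⟨i, hi, j, hj, k, hk, hij, hik, hjk, hne⟩ := exists_sum_codeword_ne_zero b
  have h := signMoment_codeword_entryPerm hx i j k
  have hsign : ∀ z, z ≠ 0 → binarySign z = -1 := by decide
  rw [hfix i hi, hfix j hj, hfix k hk, hb, hsign _ hne] at h
  have := signMoment_codeword_ne_zero i hi j hj k hk hij hik hjk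
  omega

theorem eq_one_of_fixes_entryBase (hx : x ∈ codeAut evenHadamardCode)
    (hfix : ∀ i ∈ entryBase, entryPerm x i = i) : x = 1 := by
  have h0 := map_zero_of_fixes_entryBase hx hfix
  refine eq_of_entryPerm_eq (Equiv.ext fun i => ?_) h0
  by_contra hne
  rw [map_one, Equiv.Perm.one_apply] at hne
  obtain ⟨a, ha, b, hb, hab⟩ := exists_signMoment_codeword_ne _ _ hne
  have h := signMoment_codeword_entryPerm hx a b i
  rw [hfix a ha, hfix b hb, h0] at h
  exact hab (by simpa using h)

theorem eq_of_entryPerm_eq_of_mem_codeAut {y : HammingAut (ZMod 11) (ZMod 2)}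
    (hx : x ∈ codeAut evenHadamardCode) (hy : y ∈ codeAut evenHadamardCode)
    (h : ∀ i ∈ entryBase, entryPerm x i = entryPerm y i) : x = y :=
  (inv_mul_eq_one.1 (eq_one_of_fixes_entryBase (mul_mem (inv_mem hy) hx) fun i hi => by
    simp [h i hi])).symm

theorem isEntryFaithful_codeAut : IsEntryFaithful (codeAut evenHadamardCode) :=
  isEntryFaithful_of_forall_eq_one fun x hx h => eq_one_of_fixes_entryBase hx fun i _ => by
    rw [h, Equiv.Perm.one_apply]

theorem card_codeAut_le : Nat.card (codeAut evenHadamardCode) ≤ 7920 := by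
  let f (x : codeAut evenHadamardCode) : entryBase ↪ ZMod 11 :=
    (Function.Embedding.subtype _).trans (entryPerm x.1).toEmbedding
  have hf : Function.Injective f := fun x y h =>
    Subtype.ext (eq_of_entryPerm_eq_of_mem_codeAut x.2 y.2 fun i hi =>
      DFunLike.congr_fun h ⟨i, hi⟩)
  refine (Nat.card_le_card_of_injective f hf).trans ?_
  rw [Nat.card_eq_fintype_card, Fintype.card_embedding_eq, ZMod.card, Fintype.card_coe]
  decide

instance : Fact (Nat.Prime 11) := ⟨by norm_num⟩

/-- The automorphism translating the entries by `b`; it maps `evenHadamardCode` to itself. -/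
def translation (b : ZMod 11) : HammingAut (ZMod 11) (ZMod 2) := permAut (Equiv.addRight b)

theorem translation_zero (b : ZMod 11) : translation b 0 = 0 := permAut_zero _

theorem entryPerm_translation (b a : ZMod 11) : entryPerm (translation b) a = a + b := by
  rw [translation, entryPerm_permAut, Equiv.coe_addRight]

theorem translation_codeword (b : ZMod 11) (d : Option (ZMod 11)) :
    translation b (codeword d) = codeword (d.map (· + b)) := by
  cases d with
  | none => exact translation_zero b
  | some c =>
    ext a
    rw [translation, permAut_apply]
    simp [codeword, sub_eq_add_neg, add_assoc]

theorem translation_mem_codeAut (b : ZMod 11) : translation b ∈ codeAut evenHadamardCode := by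
  rw [evenHadamardCode_eq_range]
  exact mem_codeAut_range_iff.2 fun d => ⟨_, translation_codeword b d⟩

theorem translation_zpow (b : ZMod 11) (k : ℤ) : translation b ^ k = translation (k • b) := by
  rw [translation, translation, ← map_zpow, Equiv.zsmul_addRight]

theorem translation_pow_eleven (b : ZMod 11) : translation b ^ 11 = 1 := by
  have h11 : ((11 : ℕ) : ℤ) • b = 0 := by
    rw [natCast_zsmul, nsmul_eq_mul, CharP.cast_eq_zero, zero_mul]
  rw [← zpow_natCast, translation_zpow, h11, translation, Equiv.addRight_zero, map_one]

theorem orderOf_translation_one : orderOf (translation 1) = 11 := by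
  refine orderOf_eq_prime (translation_pow_eleven 1) fun h => ?_
  have h01 := entryPerm_translation 1 0
  rw [h, map_one, Equiv.Perm.one_apply] at h01
  simp at h01

theorem pow_five_eq_one_of_codeword_mul : ∀ u e,
    (∀ a, codeword e (a * u) = codeword (some 0) a) → u ^ 5 = 1 := by
  decide +kernel

theorem exists_pow_five_eq_one_of_normalizes_translation {u : ZMod 11}
    (hx : x ∈ codeAut evenHadamardCode) (h : x * translation 1 = translation u * x) :
    ∃ b, (translation b * x) ^ 5 = 1 := by
  have hentry (a : ZMod 11) : entryPerm x (a + 1) = entryPerm x a + u := by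
    have := congrArg (entryPerm · a) h
    simpa [entryPerm_translation] using this
  have hu : u ≠ 0 := by
    rintro rfl
    simpa using hentry 0
  have hx0 : x 0 = 0 := by
    obtain ⟨_ | d, hd⟩ := exists_map_zero_eq_codeword hx
    · exact hd
    · have h0 : x (translation 1 0) = translation u (x 0) := DFunLike.congr_fun h 0
      rw [translation_zero, hd, translation_codeword] at h0
      simp [codeword_injective.eq_iff, hu] at h0
  have haffine (k : ℕ) : entryPerm x k = entryPerm x 0 + k * u := by
    induction k with
    | zero => simp
    | succ k ih => rw [Nat.cast_succ, hentry, ih]; ring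
  set y := translation (-entryPerm x 0) * x with hy
  have hyC : y ∈ codeAut evenHadamardCode := mul_mem (translation_mem_codeAut _) hx
  have hy0 : y 0 = 0 := by rw [hy, RelIso.mul_apply, hx0, translation_zero]
  have hdil (a : ZMod 11) : entryPerm y a = a * u := by
    have := haffine a.val
    rw [ZMod.natCast_zmod_val] at this
    simp [hy, entryPerm_translation, this]
  have hu5 : u ^ 5 = 1 := by
    obtain ⟨π, hπ⟩ := exists_codewordPerm hyC
    refine pow_five_eq_one_of_codeword_mul u (π (some 0)) fun a => ?_
    rw [← hdil, ← hπ, apply_entryPerm, hy0, Pi.zero_apply, add_zero]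
  have hpow (k : ℕ) (a : ZMod 11) : entryPerm (y ^ k) a = a * u ^ k := by
    induction k with
    | zero => simp
    | succ k ih => rw [pow_succ', map_mul, Equiv.Perm.mul_apply, hdil, ih, pow_succ, mul_assoc]
  refine ⟨_, eq_one_of_fixes_entryBase (pow_mem hyC 5) fun i _ => ?_⟩
  rw [hpow, hu5, mul_one]

theorem relIndex_codeAut_lt_five {X : Subgroup (HammingAut (ZMod 11) (ZMod 2))}
    (hX : X ≤ codeAut evenHadamardCode) (hcard : 1980 ∣ Nat.card X) :
    X.relIndex (codeAut evenHadamardCode) < 5 := by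
  have hindex : Nat.card X * X.relIndex (codeAut evenHadamardCode) =
      Nat.card (codeAut evenHadamardCode) := by
    simpa using Subgroup.relIndex_mul_relIndex ⊥ X (codeAut evenHadamardCode) bot_le hX
  have hle := card_codeAut_le
  have hge := Nat.le_of_dvd Nat.card_pos hcard
  rw [← hindex] at hle
  nlinarith

theorem mem_of_normalizes_translation {X : Subgroup (HammingAut (ZMod 11) (ZMod 2))}
    (hX : X.relIndex (codeAut evenHadamardCode) < 5) {u : ZMod 11}
    (hx : x ∈ codeAut evenHadamardCode) (h : x * translation 1 = translation u * x) : x ∈ X := by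
  have h0 : X.relIndex (codeAut evenHadamardCode) ≠ 0 := Subgroup.index_ne_zero_of_finite
  obtain ⟨b, hb⟩ := exists_pow_five_eq_one_of_normalizes_translation hx h
  have hbt : translation b ∈ X :=
    mem_of_pow_prime_pow_eq_one (p := 11) Fact.out h0 (by omega) (translation_mem_codeAut b)
      (k := 1) (translation_pow_eleven b)
  have hbx : translation b * x ∈ X :=
    mem_of_pow_prime_pow_eq_one (p := 5) (by norm_num) h0 hX
      (mul_mem (translation_mem_codeAut b) hx) (k := 1) hb
  exact (X.mul_mem_cancel_left hbt).1 hbx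

theorem eq_codeAut_of_dvd_card {X : Subgroup (HammingAut (ZMod 11) (ZMod 2))}
    (hX : X ≤ codeAut evenHadamardCode) (hcard : 1980 ∣ Nat.card X) :
    X = codeAut evenHadamardCode := by
  have hlt := relIndex_codeAut_lt_five hX hcard
  let t : codeAut evenHadamardCode := ⟨translation 1, translation_mem_codeAut 1⟩
  have ht : Nat.card (Subgroup.zpowers t) = 11 := by
    rw [Nat.card_zpowers, Subgroup.orderOf_mk, orderOf_translation_one]
  have hndvd : ¬ 11 ∣ (Subgroup.zpowers t).index := by
    have hmul := (Subgroup.zpowers t).card_mul_index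
    rw [ht] at hmul
    have hpos := Nat.card_pos (α := codeAut evenHadamardCode)
    have hle := card_codeAut_le
    have hdvd := hcard.trans (Subgroup.card_dvd_of_le hX)
    omega
  let P : Sylow 11 (codeAut evenHadamardCode) :=
    (IsPGroup.of_card (n := 1) (ht.trans (pow_one 11).symm)).toSylow hndvd
  have hlt' : (X.subgroupOf (codeAut evenHadamardCode)).index < 11 := hlt.trans (by norm_num)
  refine hX.antisymm (Subgroup.subgroupOf_eq_top.1
    (eq_top_of_index_lt_of_normalizer_le hlt' P fun y hy => ?_))
  obtain ⟨k, hk⟩ : y * t * y⁻¹ ∈ Subgroup.zpowers t :=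
    (Subgroup.mem_normalizer_iff.1 hy t).1 (Subgroup.mem_zpowers t)
  have hyt := congrArg Subtype.val (mul_inv_eq_iff_eq_mul.1 hk.symm)
  exact mem_of_normalizes_translation hlt (u := k) y.2 (by simpa [t, translation_zpow] using hyt)

theorem card_evenHadamardCode : Nat.card evenHadamardCode = 12 := by
  rw [evenHadamardCode_eq_range, Nat.card_range_of_injective codeword_injective,
    Nat.card_eq_fintype_card, Fintype.card_option, ZMod.card]

theorem card_neighbourSet_evenHadamardCode_two :
    Nat.card (neighbourSet evenHadamardCode 2) = 660 := by
  have hdist : ∀ β ∈ evenHadamardCode, ∀ γ ∈ evenHadamardCode, β ≠ γ →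
      2 * 2 < hammingDist β γ := by
    rw [evenHadamardCode_eq_range]
    rintro _ ⟨d, rfl⟩ _ ⟨e, rfl⟩ hne
    rw [hammingDist_codeword d e fun h => hne (congrArg codeword h)]
    norm_num
  rw [card_neighbourSet hdist, card_evenHadamardCode, card_hammingNorm_eq, ZMod.card]
  rfl

theorem isHadamard_signMatrix_codeword : (signMatrix codeword).IsHadamard :=
  isHadamard_signMatrix fun d e h => by
    rw [hammingDist_codeword d e h, Fintype.card_option, ZMod.card]

theorem dvd_card_of_isNeighbourTransitive {X : Subgroup (HammingAut (ZMod 11) (ZMod 2))}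
    (hX : IsNeighbourTransitive X 2 evenHadamardCode) : 1980 ∣ Nat.card X := by
  obtain ⟨hle, horbit⟩ := hX
  have h660 : 660 ∣ Nat.card X := by
    obtain ⟨α, hα⟩ := horbit 2 le_rfl
    rw [← card_neighbourSet_evenHadamardCode_two, hα]
    simpa using card_orbit_mul_orderOf_dvd_card (one_smul X α)
  obtain ⟨z, hz⟩ := exists_prime_orderOf_dvd_card' (G := X) 3 (by omega)
  obtain ⟨π, hπ⟩ := exists_codewordPerm (hle z.2)
  obtain ⟨d, hd⟩ := exists_fixed_codeword_of_odd_order isHadamard_signMatrix_codeword hπ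
    (n := 3) (by decide) (by simpa [hz] using congrArg Subtype.val (pow_orderOf_eq_one z))
  have h36 : 36 ∣ Nat.card X := by
    obtain ⟨α, hα⟩ := horbit 0 (by norm_num)
    rw [neighbourSet_zero] at hα
    have hdα : codeword d ∈ MulAction.orbit X α :=
      hα ▸ evenHadamardCode_eq_range ▸ Set.mem_range_self d
    have hcard := card_orbit_mul_orderOf_dvd_card (show z • codeword d = codeword d from hd)
    rwa [MulAction.orbit_eq_iff.2 hdα, ← hα, card_evenHadamardCode, hz] at hcard
  omega

theorem eq_codeAut_of_isNeighbourTransitive {X : Subgroup (HammingAut (ZMod 11) (ZMod 2))}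
    (hX : IsNeighbourTransitive X 2 evenHadamardCode) : X = codeAut evenHadamardCode :=
  eq_codeAut_of_dvd_card hX.1 (dvd_card_of_isNeighbourTransitive hX)

/-- The second standard generator of the Mathieu group, as a permutation of `𝔽₁₁`. -/
def mathieuGen : Equiv.Perm (ZMod 11) :=
  List.formPerm [2, 6, 10, 7] * List.formPerm [3, 9, 4, 5]

theorem mathieuM11_eq_closure :
    mathieuM11 = Subgroup.closure {Equiv.addRight (1 : ZMod 11), mathieuGen} := by
  have hrotate : finRotate 11 = Equiv.addRight (1 : ZMod 11) := Equiv.ext (by decide)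
  exact congrArg (fun σ : Equiv.Perm (ZMod 11) => Subgroup.closure {σ, mathieuGen}) hrotate

/-- The automorphism of `evenHadamardCode` inducing `mathieuGen` on the entries. -/
def mathieuGenAut : HammingAut (ZMod 11) (ZMod 2) := signedPerm mathieuGen (codeword (some 0))

theorem mathieuGenAut_mem_codeAut : mathieuGenAut ∈ codeAut evenHadamardCode := by
  rw [evenHadamardCode_eq_range]
  exact signedPerm_mem_codeAut_range (by decide +kernel)

/-- The group generated by the automorphisms of `evenHadamardCode` inducing the standard generators
of the Mathieu group on the entries. -/
def mathieuAut : Subgroup (HammingAut (ZMod 11) (ZMod 2)) :=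
  Subgroup.closure {translation 1, mathieuGenAut}

theorem mathieuAut_le_codeAut : mathieuAut ≤ codeAut evenHadamardCode := by
  rw [mathieuAut, Subgroup.closure_le]
  rintro _ (rfl | rfl)
  · exact translation_mem_codeAut 1
  · exact mathieuGenAut_mem_codeAut

theorem map_entryPerm_mathieuAut : mathieuAut.map entryPerm = mathieuM11 := by
  rw [mathieuM11_eq_closure, mathieuAut, MonoidHom.map_closure, Set.image_pair, translation,
    entryPerm_permAut, mathieuGenAut, entryPerm_signedPerm]

theorem translation_mem_mathieuAut (b : ZMod 11) : translation b ∈ mathieuAut := by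
  have hpow : translation 1 ^ (b.val : ℤ) ∈ mathieuAut :=
    zpow_mem (Subgroup.subset_closure (Set.mem_insert _ _)) _
  simpa [translation_zpow] using hpow

theorem mathieuGenAut_mem_mathieuAut : mathieuGenAut ∈ mathieuAut :=
  Subgroup.subset_closure (Set.mem_insert_of_mem _ rfl)

theorem exists_dilation_mem_mathieuAut :
    ∃ x ∈ mathieuAut, x 0 = 0 ∧ ∀ a, entryPerm x a = 3 * a := by
  let t := translation
  let g := mathieuGenAut
  have ht := translation_mem_mathieuAut
  have hg := mathieuGenAut_mem_mathieuAut
  refine ⟨t 6 * g * (t 8 * g) * (t 10 * g), mul_mem (mul_mem (mul_mem (ht 6) hg)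
    (mul_mem (ht 8) hg)) (mul_mem (ht 10) hg), ?_, ?_⟩
  · decide +kernel
  · simp only [t, g, map_mul, translation, entryPerm_permAut, mathieuGenAut, entryPerm_signedPerm]
    decide +kernel

theorem evenHadamardCode_eq_orbit_mathieuAut :
    evenHadamardCode = MulAction.orbit mathieuAut (0 : ZMod 11 → ZMod 2) := by
  have h0 : 0 ∈ evenHadamardCode := evenHadamardCode_eq_range ▸ ⟨none, codeword_none⟩
  refine Set.Subset.antisymm ?_ ?_
  · rw [evenHadamardCode_eq_range]
    rintro _ ⟨_ | b, rfl⟩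
    · exact MulAction.mem_orbit_self _
    · refine ⟨⟨translation b * mathieuGenAut,
        mul_mem (translation_mem_mathieuAut b) mathieuGenAut_mem_mathieuAut⟩, ?_⟩
      change translation b (mathieuGenAut 0) = _
      rw [mathieuGenAut, signedPerm_zero, translation_codeword, Option.map_some, zero_add]
  · rintro _ ⟨x, rfl⟩
    exact (MulAction.mem_stabilizer_set.1 (mathieuAut_le_codeAut x.2) 0).2 h0

theorem mem_neighbourSet_evenHadamardCode {α : ZMod 11 → ZMod 2} (hα : hammingNorm α ≤ 3) :
    α ∈ neighbourSet evenHadamardCode (hammingNorm α) := by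
  rw [evenHadamardCode_eq_range]
  refine mem_neighbourSet_of_hammingDist_eq ⟨none, codeword_none⟩ ?_ (hammingDist_zero_right α)
  rintro _ ⟨_ | b, rfl⟩ hne
  · exact absurd codeword_none hne
  · rw [← codeword_none, hammingDist_codeword _ _ (by simp)]
    omega

theorem exists_affine_mem_mathieuAut (b : ZMod 11) (k : ℕ) :
    ∃ x ∈ mathieuAut, x 0 = 0 ∧ ∀ a, entryPerm x a = 3 ^ k * a + b := by
  obtain ⟨y, hy, hy0, hya⟩ := exists_dilation_mem_mathieuAut
  induction k with
  | zero => exact ⟨translation b, translation_mem_mathieuAut b, translation_zero b, fun a => by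
      rw [entryPerm_translation, pow_zero, one_mul]⟩
  | succ k ih =>
    obtain ⟨x, hx, hx0, hxa⟩ := ih
    exact ⟨x * y, mul_mem hx hy, by rw [RelIso.mul_apply, hy0, hx0], fun a => by
      rw [map_mul, Equiv.Perm.mul_apply, hya, hxa, pow_succ, mul_assoc]⟩

theorem mem_orbit_mathieuAut_of_hammingNorm_eq_one {α : ZMod 11 → ZMod 2} (h : hammingNorm α = 1) :
    α ∈ MulAction.orbit mathieuAut (Pi.single 0 1 : ZMod 11 → ZMod 2) := by
  obtain ⟨i, rfl⟩ := exists_eq_single_of_hammingNorm_eq_one h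
  refine ⟨⟨translation i, translation_mem_mathieuAut i⟩, ?_⟩
  change translation i (Pi.single 0 1) = _
  rw [map_single_of_map_zero (translation_zero i), entryPerm_translation, zero_add]

/-- The powers of `3` are the squares of `𝔽₁₁ˣ`, and `-1` is not a square. -/
theorem mem_orbit_mathieuAut_of_hammingNorm_eq_two {α : ZMod 11 → ZMod 2} (h : hammingNorm α = 2) :
    α ∈ MulAction.orbit mathieuAut (Pi.single 0 1 + Pi.single 1 1 : ZMod 11 → ZMod 2) := by
  have hpow : ∀ c : ZMod 11, c ≠ 0 → ∃ k < 5, 3 ^ k = c ∨ 3 ^ k = -c := by decide +kernel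
  have hmem (b : ZMod 11) (k : ℕ) : Pi.single b 1 + Pi.single (3 ^ k + b) 1 ∈
      MulAction.orbit mathieuAut (Pi.single 0 1 + Pi.single 1 1 : ZMod 11 → ZMod 2) := by
    obtain ⟨x, hx, hx0, hxa⟩ := exists_affine_mem_mathieuAut b k
    refine ⟨⟨x, hx⟩, ?_⟩
    change x (Pi.single 0 1 + Pi.single 1 1) = _
    rw [map_add_of_map_zero hx0, map_single_of_map_zero hx0, map_single_of_map_zero hx0, hxa, hxa,
      mul_zero, zero_add, mul_one]
  obtain ⟨i, j, hij, rfl⟩ := exists_eq_single_add_single_of_hammingNorm_eq_two h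
  obtain ⟨k, -, hk | hk⟩ := hpow (j - i) (sub_ne_zero.2 hij.symm)
  · have hj := hmem i k
    rwa [hk, sub_add_cancel] at hj
  · have hi := hmem j k
    rwa [hk, neg_sub, sub_add_cancel, add_comm (Pi.single j 1)] at hi

theorem isNeighbourTransitive_mathieuAut :
    IsNeighbourTransitive mathieuAut 2 evenHadamardCode := by
  refine ⟨mathieuAut_le_codeAut, fun r hr => ?_⟩
  have hE := evenHadamardCode_eq_orbit_mathieuAut
  interval_cases r
  · exact ⟨0, by rw [neighbourSet_zero, hE]⟩
  · exact ⟨_, neighbourSet_eq_orbit mathieuAut_le_codeAut hE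
      (mem_neighbourSet_evenHadamardCode (α := Pi.single 0 1) (by decide))
      fun γ hγ => mem_orbit_mathieuAut_of_hammingNorm_eq_one (by simpa using hγ)⟩
  · exact ⟨_, neighbourSet_eq_orbit mathieuAut_le_codeAut hE
      (mem_neighbourSet_evenHadamardCode (α := Pi.single 0 1 + Pi.single 1 1) (by decide))
      fun γ hγ => mem_orbit_mathieuAut_of_hammingNorm_eq_two (by simpa using hγ)⟩

theorem mathieuAut_eq_codeAut : mathieuAut = codeAut evenHadamardCode :=
  eq_codeAut_of_isNeighbourTransitive isNeighbourTransitive_mathieuAut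

theorem isNeighbourTransitive_two_iff {X : Subgroup (HammingAut (ZMod 11) (ZMod 2))} :
    IsNeighbourTransitive X 2 evenHadamardCode ↔ X = codeAut evenHadamardCode :=
  ⟨eq_codeAut_of_isNeighbourTransitive, fun h =>
    h ▸ mathieuAut_eq_codeAut ▸ isNeighbourTransitive_mathieuAut⟩

theorem nonempty_codeAut_mulEquiv_mathieuM11 :
    Nonempty (codeAut evenHadamardCode ≃* mathieuM11) := by
  have hinj : Function.Injective (entryPerm.comp (codeAut evenHadamardCode).subtype) := fun x y h =>
    Subtype.ext (eq_of_entryPerm_eq_of_mem_codeAut x.2 y.2 fun i _ => DFunLike.congr_fun h i)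
  have hrange : (entryPerm.comp (codeAut evenHadamardCode).subtype).range = mathieuM11 := by
    rw [MonoidHom.range_comp, Subgroup.range_subtype, ← mathieuAut_eq_codeAut,
      map_entryPerm_mathieuAut]
  exact ⟨(MonoidHom.ofInjective hinj).trans (MulEquiv.subgroupCongr hrange)⟩

/-- The two orbits of triples of entries are told apart by the number of codewords at distance
three. -/
theorem exists_card_hammingDist_codeword_ne : ∃ α β : ZMod 11 → ZMod 2,
    hammingNorm α = 3 ∧ hammingNorm β = 3 ∧
      Finset.card {d | hammingDist α (codeword d) = 3} ≠
        Finset.card {d | hammingDist β (codeword d) = 3} :=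
  ⟨Pi.single 0 1 + Pi.single 1 1 + Pi.single 2 1, Pi.single 0 1 + Pi.single 2 1 + Pi.single 3 1,
    by decide +kernel⟩

theorem not_isNeighbourTransitive_three (X : Subgroup (HammingAut (ZMod 11) (ZMod 2))) :
    ¬ IsNeighbourTransitive X 3 evenHadamardCode := by
  rintro ⟨hX, horbit⟩
  obtain ⟨α, β, hα, hβ, hne⟩ := exists_card_hammingDist_codeword_ne
  obtain ⟨γ, hγ⟩ := horbit 3 le_rfl
  have hαγ := hα ▸ mem_neighbourSet_evenHadamardCode hα.le
  have hβγ := hβ ▸ mem_neighbourSet_evenHadamardCode hβ.le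
  rw [hγ] at hαγ hβγ
  rw [← MulAction.orbit_eq_iff.2 hβγ] at hαγ
  obtain ⟨x, rfl⟩ := hαγ
  obtain ⟨π, hπ⟩ := exists_codewordPerm (hX x.2)
  exact hne (card_hammingDist_map hπ β 3)

theorem not_isCompletelyTransitive (X : Subgroup (HammingAut (ZMod 11) (ZMod 2))) :
    ¬ IsCompletelyTransitive X evenHadamardCode := by
  obtain ⟨α, -, hα, -⟩ := exists_card_hammingDist_codeword_ne
  exact fun h => not_isNeighbourTransitive_three X (h.mono (le_coveringRadius
    ⟨α, hα ▸ mem_neighbourSet_evenHadamardCode hα.le⟩))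

end EvenHadamardCode

theorem lemma4p2 :
    (∀ X : Subgroup (HammingAut (ZMod 11) (ZMod 2)),
      (IsNeighbourTransitive X 2 evenHadamardCode ∧ IsEntryFaithful X) ↔
        X = codeAut evenHadamardCode) ∧
    Nonempty (codeAut evenHadamardCode ≃* mathieuM11) ∧
    IsEntryFaithful (codeAut evenHadamardCode) ∧
    (∀ X : Subgroup (HammingAut (ZMod 11) (ZMod 2)),
      ¬ IsNeighbourTransitive X 3 evenHadamardCode) ∧
    (∀ X : Subgroup (HammingAut (ZMod 11) (ZMod 2)),
      ¬ IsCompletelyTransitive X evenHadamardCode) := by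
  exact ⟨fun _ => ⟨fun h => isNeighbourTransitive_two_iff.1 h.1, fun h =>
      ⟨isNeighbourTransitive_two_iff.2 h, h ▸ isEntryFaithful_codeAut⟩⟩,
    nonempty_codeAut_mulEquiv_mathieuM11, isEntryFaithful_codeAut, not_isNeighbourTransitive_three,
    not_isCompletelyTransitive⟩
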